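/- A directed 2-complex $\mathcal K$ is a directed graph together with a set of 2-cells; each 2-cell $f$ has a nonempty top path $\lceil f\rceil$ and a nonempty bottom path $\lfloor f\rfloor$, two directed paths with the same initial vertex and the same terminal vertex, and there is a fixed-point-free involution $f\mapsto f^{-1}$ on the 2-cells that exchanges top and bottom. There are no restrictions on cardinalities. A 1-path is a directed path. An atomic 2-path $(p,f,q)$ leads from the 1-path $p\lceil f\rceil q$ to the 1-path $p\lfloor f\rfloor q$, and a 2-path is a finite (possibly empty) composable sequence of atomic 2-paths. Homotopy of 2-paths is the smallest equivalence relation, compatible with concatenation, under which $(p,f,q)\circ(p,f^{-1},q)$ is homotopic to the empty 2-path and $$(p,f,q\lceil g\rceil r)\circ(p\lfloor f\rfloor q,g,r)\quad\text{is homotopic to}\quad(p\lceil f\rceil q,g,r)\circ(p,f,q\lfloor g\rfloor r).$$ The diagram group $\mathcal D(\mathcal K,w)$ with base a 1-path $w$ is the group of homotopy classes of 2-paths from $w$ to $w$ under concatenation (equivalently, the group of $(w,w)$-diagrams over $\mathcal K$ modulo cancellation of dipoles). **Theorem.** Every diagram group is residually countable: for every directed 2-complex $\mathcal K$, every 1-path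 $w$ of $\mathcal K$ and every $g\neq 1$ in $\mathcal D(\mathcal K,w)$, there is a surjective homomorphism $\varphi$ from $\mathcal D(\mathcal K,w)$ onto an (at most) countable group with $\varphi(g)\neq 1$. -/

import Mathlib

universe u v w

/-- A directed 2-complex on the directed graph `V`. Its 1-paths are the directed paths
`Quiver.Path a b`, empty paths included. `Cell a b` is the set of all 2-cells, positive and
negative, whose top and bottom paths run from `a` to `b`; both of these paths are nonempty. The
map `inv` is the fixed-point-free involution `f ↦ f⁻¹`, which exchanges top and bottom. -/
structure DirectedTwoComplex (V : Type u) [Quiver.{v} V] where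
  /-- The 2-cells with initial vertex `a` and terminal vertex `b`. -/
  Cell : V → V → Type w
  /-- The top path of a 2-cell. -/
  top : ∀ {a b : V}, Cell a b → Quiver.Path a b
  /-- The bottom path of a 2-cell. -/
  bot : ∀ {a b : V}, Cell a b → Quiver.Path a b
  /-- The inverse of a 2-cell. -/
  inv : ∀ {a b : V}, Cell a b → Cell a b
  top_nonempty : ∀ {a b : V} (f : Cell a b), (top f).length ≠ 0
  bot_nonempty : ∀ {a b : V} (f : Cell a b), (bot f).length ≠ 0
  inv_inv : ∀ {a b : V} (f : Cell a b), inv (inv f) = f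
  inv_ne : ∀ {a b : V} (f : Cell a b), inv f ≠ f
  top_inv : ∀ {a b : V} (f : Cell a b), top (inv f) = bot f
  bot_inv : ∀ {a b : V} (f : Cell a b), bot (inv f) = top f

namespace DirectedTwoComplex

variable {V : Type u} [Quiver.{v} V] (K : DirectedTwoComplex.{u, v, w} V) {a b : V}

/-- An atomic 2-path `(p, f, q)` from the 1-path `P = p ⌈f⌉ q` to the 1-path `Q = p ⌊f⌋ q`, where
`⌈f⌉` and `⌊f⌋` are the top and the bottom of the 2-cell `f`. -/
structure AtomicTwoPath (P Q : Quiver.Path a b) where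
  {x : V}
  {y : V}
  left : Quiver.Path a x
  cell : K.Cell x y
  right : Quiver.Path y b
  eq_top : P = (left.comp (K.top cell)).comp right
  eq_bot : Q = (left.comp (K.bot cell)).comp right

variable {K} in
/-- The inverse `(p, f⁻¹, q)` of the atomic 2-path `(p, f, q)`. -/
def AtomicTwoPath.inv {P Q : Quiver.Path a b} (s : K.AtomicTwoPath P Q) :
    K.AtomicTwoPath Q P where
  left := s.left
  cell := K.inv s.cell
  right := s.right
  eq_top := by rw [K.top_inv]; exact s.eq_bot
  eq_bot := by rw [K.bot_inv]; exact s.eq_top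

/-- A 2-path from `P` to `Q`: a finite, possibly empty, sequence of composable atomic 2-paths. -/
inductive TwoPath : Quiver.Path a b → Quiver.Path a b → Type (max u v w)
  | nil (P : Quiver.Path a b) : TwoPath P P
  | cons {P Q R : Quiver.Path a b} (s : K.AtomicTwoPath P Q) (δ : TwoPath Q R) : TwoPath P R

namespace TwoPath

variable {K}

/-- The 2-path consisting of one atomic 2-path. -/
def single {P Q : Quiver.Path a b} (s : K.AtomicTwoPath P Q) : K.TwoPath P Q :=
  cons s (nil Q)

/-- Concatenation of 2-paths. -/
def comp {P Q R : Quiver.Path a b} : K.TwoPath P Q → K.TwoPath Q R → K.TwoPath P R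
  | nil _, ε => ε
  | cons s δ, ε => cons s (comp δ ε)

/-- The inverse of a 2-path: the inverses of its terms in the opposite order. -/
def reverse {P Q : Quiver.Path a b} : K.TwoPath P Q → K.TwoPath Q P
  | nil P => nil P
  | cons s δ => comp (reverse δ) (single s.inv)

/-- The 2-path `(p, f, q ⌈g⌉ r) ∘ (p ⌊f⌋ q, g, r)`. -/
def leftFirst {x y z t : V} (p : Quiver.Path a x) (f : K.Cell x y) (q : Quiver.Path y z)
    (g : K.Cell z t) (r : Quiver.Path t b) :
    K.TwoPath ((((p.comp (K.top f)).comp q).comp (K.top g)).comp r)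
      ((((p.comp (K.bot f)).comp q).comp (K.bot g)).comp r) :=
  cons (Q := (((p.comp (K.bot f)).comp q).comp (K.top g)).comp r)
    ⟨p, f, (q.comp (K.top g)).comp r, by simp only [Quiver.Path.comp_assoc],
      by simp only [Quiver.Path.comp_assoc]⟩
    (single ⟨(p.comp (K.bot f)).comp q, g, r, rfl, rfl⟩)

/-- The 2-path `(p ⌈f⌉ q, g, r) ∘ (p, f, q ⌊g⌋ r)`. -/
def rightFirst {x y z t : V} (p : Quiver.Path a x) (f : K.Cell x y) (q : Quiver.Path y z)
    (g : K.Cell z t) (r : Quiver.Path t b) :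
    K.TwoPath ((((p.comp (K.top f)).comp q).comp (K.top g)).comp r)
      ((((p.comp (K.bot f)).comp q).comp (K.bot g)).comp r) :=
  cons (Q := (((p.comp (K.top f)).comp q).comp (K.bot g)).comp r)
    ⟨(p.comp (K.top f)).comp q, g, r, rfl, rfl⟩
    (single ⟨p, f, (q.comp (K.bot g)).comp r, by simp only [Quiver.Path.comp_assoc],
      by simp only [Quiver.Path.comp_assoc]⟩)

/-- Homotopy of 2-paths: the smallest equivalence relation compatible with concatenation that
contains the isotopies (independent atomic 2-paths may be interchanged; 2-paths are isotopic
exactly when they have the same diagram) and the cancellations of dipoles. -/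
inductive Homotopic : ∀ {P Q : Quiver.Path a b}, K.TwoPath P Q → K.TwoPath P Q → Prop
  | refl {P Q : Quiver.Path a b} (δ : K.TwoPath P Q) : Homotopic δ δ
  | symm {P Q : Quiver.Path a b} {δ ε : K.TwoPath P Q} : Homotopic δ ε → Homotopic ε δ
  | trans {P Q : Quiver.Path a b} {δ ε ζ : K.TwoPath P Q} :
      Homotopic δ ε → Homotopic ε ζ → Homotopic δ ζ
  | comp {P Q R : Quiver.Path a b} {δ δ' : K.TwoPath P Q} {ε ε' : K.TwoPath Q R} :
      Homotopic δ δ' → Homotopic ε ε' → Homotopic (comp δ ε) (comp δ' ε')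
  | dipole {P Q : Quiver.Path a b} (s : K.AtomicTwoPath P Q) :
      Homotopic (comp (single s) (single s.inv)) (nil P)
  | isotopy {x y z t : V} (p : Quiver.Path a x) (f : K.Cell x y) (q : Quiver.Path y z)
      (g : K.Cell z t) (r : Quiver.Path t b) :
      Homotopic (leftFirst p f q g r) (rightFirst p f q g r)

theorem comp_nil {P Q : Quiver.Path a b} (δ : K.TwoPath P Q) : comp δ (nil Q) = δ := by
  induction δ with
  | nil P => rfl
  | cons s δ ih => simp only [comp, ih]

theorem comp_assoc {P Q R S : Quiver.Path a b} (δ : K.TwoPath P Q) (ε : K.TwoPath Q R)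
    (ζ : K.TwoPath R S) : comp (comp δ ε) ζ = comp δ (comp ε ζ) := by
  induction δ with
  | nil P => rfl
  | cons s δ ih => simp only [comp, ih]

theorem inv_inv_atomic {P Q : Quiver.Path a b} (s : K.AtomicTwoPath P Q) : s.inv.inv = s := by
  cases s
  simp only [AtomicTwoPath.inv, K.inv_inv]

theorem comp_reverse {P Q : Quiver.Path a b} (δ : K.TwoPath P Q) :
    Homotopic (comp δ (reverse δ)) (nil P) := by
  induction δ with
  | nil P => exact Homotopic.refl _
  | cons s δ ih =>
    have h : comp (cons s δ) (reverse (cons s δ)) =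
        comp (single s) (comp (comp δ (reverse δ)) (single s.inv)) := by
      rw [comp_assoc]; rfl
    rw [h]
    exact (Homotopic.comp (Homotopic.refl _) (Homotopic.comp ih (Homotopic.refl _))).trans
      (Homotopic.dipole s)

theorem reverse_comp {P Q : Quiver.Path a b} (δ : K.TwoPath P Q) :
    Homotopic (comp (reverse δ) δ) (nil Q) := by
  induction δ with
  | nil P => exact Homotopic.refl _
  | cons s δ ih =>
    have h : comp (reverse (cons s δ)) (cons s δ) =
        comp (reverse δ) (comp (comp (single s.inv) (single s.inv.inv)) δ) := by
      rw [inv_inv_atomic, comp_assoc]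
      simp only [reverse, comp_assoc]
      rfl
    rw [h]
    exact (Homotopic.comp (Homotopic.refl _)
      (Homotopic.comp (Homotopic.dipole s.inv) (Homotopic.refl _))).trans ih

theorem Homotopic.reverse {P Q : Quiver.Path a b} {δ ε : K.TwoPath P Q} (h : Homotopic δ ε) :
    Homotopic (TwoPath.reverse δ) (TwoPath.reverse ε) := by
  have h₁ : Homotopic (TwoPath.comp (TwoPath.reverse δ) (TwoPath.comp ε (TwoPath.reverse ε)))
      (TwoPath.reverse δ) := by
    simpa only [comp_nil] using
      Homotopic.comp (Homotopic.refl (TwoPath.reverse δ)) (comp_reverse ε)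
  have h₂ : Homotopic (TwoPath.comp (TwoPath.reverse δ) (TwoPath.comp ε (TwoPath.reverse ε)))
      (TwoPath.reverse ε) := by
    rw [← comp_assoc]
    exact Homotopic.comp ((Homotopic.comp (Homotopic.refl _) h.symm).trans (reverse_comp δ))
      (Homotopic.refl (TwoPath.reverse ε))
  exact h₁.symm.trans h₂

end TwoPath

/-- Homotopy as a setoid on the 2-paths from `p` to `p`. -/
def homotopySetoid (p : Quiver.Path a b) : Setoid (K.TwoPath p p) where
  r := TwoPath.Homotopic
  iseqv := ⟨TwoPath.Homotopic.refl, TwoPath.Homotopic.symm, TwoPath.Homotopic.trans⟩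

/-- The diagram group of `K` with base `p`: the homotopy classes of 2-paths from `p` to `p`
(equivalently, of `(p, p)`-diagrams over `K`), multiplied by concatenation. -/
def DiagramGroup (p : Quiver.Path a b) : Type (max u v w) :=
  Quotient (K.homotopySetoid p)

instance (p : Quiver.Path a b) : Group (K.DiagramGroup p) where
  mul := Quotient.map₂ TwoPath.comp fun _ _ h _ _ h' => TwoPath.Homotopic.comp h h'
  one := Quotient.mk (K.homotopySetoid p) (TwoPath.nil p)
  inv := Quotient.map TwoPath.reverse fun _ _ h => TwoPath.Homotopic.reverse h
  mul_assoc := by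
    rintro ⟨δ⟩ ⟨ε⟩ ⟨ζ⟩
    exact congrArg (Quotient.mk (K.homotopySetoid p)) (TwoPath.comp_assoc δ ε ζ)
  one_mul := by
    rintro ⟨δ⟩
    rfl
  mul_one := by
    rintro ⟨δ⟩
    exact congrArg (Quotient.mk (K.homotopySetoid p)) (TwoPath.comp_nil δ)
  inv_mul_cancel := by
    rintro ⟨δ⟩
    exact Quotient.sound (s := K.homotopySetoid p) (TwoPath.reverse_comp δ)

end DirectedTwoComplex

/-- A group is residually countable if every nontrivial element survives in some countable
(possibly finite) quotient group. -/
def IsResiduallyCountable (G : Type u) [Group G] : Prop :=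
  ∀ g : G, g ≠ 1 → ∃ (H : Type) (_ : Group H) (φ : G →* H),
    Countable H ∧ Function.Surjective φ ∧ φ g ≠ 1

/-!
Replace every atomic 2-path `(p, f, q)` by the letter `(|p|, f)`, so that a 2-path becomes a word
(`TwoPath.word`). The two kinds of homotopies become rewriting rules on words: delete a dipole
`(n, f) (n, f⁻¹)`, and replace `(n + |⌈f⌉| + k, g) (n, f)` by `(n, f) (n + |⌊f⌋| + k, g)`, which
orders independent cells from left to right. The rules refer to a 2-cell only through its inverse
and the lengths of its top and bottom paths; they make sense for letters over any set of labels
that carry these data (`CellSystem`). They terminate, since the list of positions decreases in the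
shortlex order, and they are locally confluent (`CellSystem.Red.locally_confluent`). By Newman's
lemma they are confluent, and a nonempty irreducible word is nontrivial in the presented monoid
(`CellSystem.eq_nil_of_con_one`).

A rewriting step on the word of a 2-path lifts to a homotopy of the 2-path
(`TwoPath.exists_homotopic_of_red`), hence an element `g ≠ 1` of the diagram group has a
representative whose word is irreducible and nonempty. Now label the 2-cells of the complex by the
lengths of their top and bottom paths, an orientation, and a number that tells apart the finitely
many cells of this representative (`exists_labelling`). There are only countably many labels, and
relabelling is compatible with the rules, so it defines a homomorphism from the diagram group to a
countable monoid. Whether a swap applies depends on positions and lengths alone, and two cells of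
the representative are mutually inverse if their labels are; therefore the relabelled word is again
irreducible and nonempty (`CellSystem.Red.of_map`), and the image of `g` is nontrivial.
-/

open Relation

/-! ### A rewriting system on words of positioned cells -/

/-- The combinatorial shadow of a set of 2-cells: of each cell only the lengths of its top and
bottom paths and its inverse cell are kept. A letter `(n, c)` stands for an atomic 2-path that
applies `c` after a prefix of length `n`; the suffix and the 1-paths themselves are forgotten. -/
structure CellSystem (C : Type*) where
  /-- The length of the top path. -/
  top : C → ℕ
  /-- The length of the bottom path. -/
  bot : C → ℕ
  /-- The inverse cell. -/
  inv : C → C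
  top_pos : ∀ c, 0 < top c
  inv_inv : ∀ c, inv (inv c) = c
  top_inv : ∀ c, top (inv c) = bot c

namespace CellSystem

variable {C : Type*} (S : CellSystem C)

theorem bot_inv (c : C) : S.bot (S.inv c) = S.top c := by
  rw [← S.top_inv, S.inv_inv]

/-- One rewriting step: a dipole is deleted, or, of two adjacent independent letters of which the
right-hand one comes first, the left-hand one is moved to the front. The equations between the
positions are hypotheses so that the constructors unify with arbitrary letters. -/
inductive Red : List (ℕ × C) → List (ℕ × C) → Prop
  | dipole {n : ℕ} {c d : C} (l : List (ℕ × C)) (hd : d = S.inv c) : Red ((n, c) :: (n, d) :: l) l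
  | swap {n m m' : ℕ} {c d : C} (l : List (ℕ × C)) (k : ℕ) (hm : m = n + S.top c + k)
      (hm' : m' = n + S.bot c + k) : Red ((m, d) :: (n, c) :: l) ((n, c) :: (m', d) :: l)
  | cons (x : ℕ × C) {l l' : List (ℕ × C)} (h : Red l l') : Red (x :: l) (x :: l')

variable {S}

/-- The list of positions decreases in the shortlex order: a swap puts the smaller position first,
because top paths are nonempty. -/
theorem Red.shortlex {l l' : List (ℕ × C)} (h : S.Red l l') :
    List.Shortlex (· < ·) (l'.map Prod.fst) (l.map Prod.fst) := by
  induction h with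
  | dipole l hd => exact List.Shortlex.of_length_lt (by simp)
  | @swap n m m' c d l k hm hm' =>
    have := S.top_pos c
    exact List.Shortlex.of_lex (by simp) (List.Lex.rel (by dsimp only; omega))
  | cons x h ih => exact List.Shortlex.append_left ih [x.1]

theorem Red.wellFounded : WellFounded fun l l' : List (ℕ × C) => S.Red l' l :=
  Subrelation.wf (fun h => Red.shortlex h)
    (InvImage.wf (List.map Prod.fst) (List.Shortlex.wf (r := (· < · : ℕ → ℕ → Prop)) wellFounded_lt))

theorem Red.append_left (u : List (ℕ × C)) {l l' : List (ℕ × C)} (h : S.Red l l') :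
    S.Red (u ++ l) (u ++ l') := by
  induction u with
  | nil => exact h
  | cons x u ih => exact Red.cons x ih

theorem Red.append_right (u : List (ℕ × C)) {l l' : List (ℕ × C)} (h : S.Red l l') :
    S.Red (l ++ u) (l' ++ u) := by
  induction h with
  | dipole l hd => exact Red.dipole _ hd
  | swap l k hm hm' => exact Red.swap _ k hm hm'
  | cons x h ih => exact Red.cons x ih

theorem not_red_nil (l : List (ℕ × C)) : ¬ S.Red [] l := by
  rintro ⟨⟩

/-- A dipole at the front of a word and any other redex. If the redexes overlap, then the word starts
with `(n, c) (n, c⁻¹) (n, c)`, or the second redex is a swap that involves `(n, c⁻¹)`, and the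
swapped letter can be moved through the whole dipole. -/
theorem Red.join_of_dipole {n : ℕ} {c d : C} {l l₂ : List (ℕ × C)} (hd : d = S.inv c)
    (h : S.Red ((n, c) :: (n, d) :: l) l₂) : Join (ReflTransGen S.Red) l l₂ := by
  subst hd
  cases h with
  | dipole _ hd' => exact ⟨_, .refl, .refl⟩
  | swap _ k hm hm' => have := S.top_pos (S.inv c); omega
  | cons _ h =>
    cases h with
    | dipole _ hd' => subst hd'; rw [S.inv_inv]; exact ⟨_, .refl, .refl⟩
    | swap _ k hm hm' =>
      exact ⟨_, .refl, .head (.swap _ k hm hm') (.single (.cons _ (.dipole _ rfl)))⟩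
    | cons _ h => exact ⟨_, .single h, .single (.dipole _ rfl)⟩

/-- A swap at the front of a word and any other redex. If the redexes overlap, then the second one
is a dipole, through which the first letter can be moved, or a swap, and three letters are put in
order in the two possible ways. -/
theorem Red.join_of_swap {n m m' : ℕ} {c d : C} {l l₂ : List (ℕ × C)} (k : ℕ)
    (hm : m = n + S.top c + k) (hm' : m' = n + S.bot c + k)
    (h : S.Red ((m, d) :: (n, c) :: l) l₂) :
    Join (ReflTransGen S.Red) ((n, c) :: (m', d) :: l) l₂ := by
  cases h with
  | dipole _ hd' => have := S.top_pos c; omega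
  | swap _ k' hk hk' =>
    obtain rfl : k = k' := by omega
    subst hm' hk'
    exact ⟨_, .refl, .refl⟩
  | cons _ h =>
    cases h with
    | dipole _ hd' =>
      subst hd'
      exact ⟨_, .head (.cons _ (.swap _ k (by rw [S.top_inv]; exact hm') rfl))
        (.single (.dipole _ rfl)), by rw [S.bot_inv, ← hm]⟩
    | swap _ j hj hj' =>
      exact ⟨_,
        .head (.cons _ (.swap _ (j + S.bot c + k) (by omega) rfl)) (.single (.swap _ j hj hj')),
        .head (.swap _ (j + S.top c + k) (by omega) rfl)
          (.single (.cons _ (.swap _ k (by omega) (by omega))))⟩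
    | cons _ h => exact ⟨_, .single (.cons _ (.cons _ h)), .single (.swap _ k hm hm')⟩

theorem Red.locally_confluent {l l₁ l₂ : List (ℕ × C)} (h₁ : S.Red l l₁) (h₂ : S.Red l l₂) :
    Join (ReflTransGen S.Red) l₁ l₂ := by
  induction h₁ generalizing l₂ with
  | dipole l hd => exact Red.join_of_dipole hd h₂
  | swap l k hm hm' => exact Red.join_of_swap k hm hm' h₂
  | cons x h ih =>
    cases h₂ with
    | dipole _ hd => exact Join.symm.symm _ _ (Red.join_of_dipole hd (.cons _ h))
    | swap _ k hm hm' => exact Join.symm.symm _ _ (Red.join_of_swap k hm hm' (.cons _ h))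
    | cons _ h₂ =>
      obtain ⟨y, hy₁, hy₂⟩ := ih h₂
      exact ⟨_ :: y, hy₁.lift (List.cons _) fun _ _ => Red.cons _,
        hy₂.lift (List.cons _) fun _ _ => Red.cons _⟩

/-- Newman's lemma: a terminating, locally confluent relation is confluent. -/
theorem _root_.Relation.ReflTransGen.join_of_locally_confluent {α : Type*} {r : α → α → Prop}
    (wf : WellFounded fun x y => r y x)
    (hr : ∀ {x y z}, r x y → r x z → Join (ReflTransGen r) y z) (x y z : α)
    (hy : ReflTransGen r x y) (hz : ReflTransGen r x z) : Join (ReflTransGen r) y z := by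
  induction x using wf.induction generalizing y z with
  | _ x ih =>
    obtain rfl | ⟨y', hxy, hy⟩ := hy.cases_head
    · exact ⟨z, hz, .refl⟩
    obtain rfl | ⟨z', hxz, hz⟩ := hz.cases_head
    · exact ⟨y, .refl, .head hxy hy⟩
    obtain ⟨t, hyt, hzt⟩ := hr hxy hxz
    obtain ⟨s, hys, hts⟩ := ih y' hxy y t hy hyt
    obtain ⟨r, hsr, hzr⟩ := ih z' hxz s z (hzt.trans hts) hz
    exact ⟨r, hys.trans hsr, hzr⟩

variable (S) in
/-- The congruence on the free monoid generated by the rewriting rules. By confluence, two words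
are congruent exactly when they have a common reduct, and this is taken as the definition. -/
def con : Con (FreeMonoid (ℕ × C)) where
  r x y := Join (ReflTransGen S.Red) x.toList y.toList
  iseqv := (equivalence_join (ReflTransGen.join_of_locally_confluent Red.wellFounded
    Red.locally_confluent)).comap FreeMonoid.toList
  mul' := by
    rintro x x' y y' ⟨u, hxu, hxu'⟩ ⟨v, hyv, hyv'⟩
    have append : ∀ {p p' q q' : List (ℕ × C)}, ReflTransGen S.Red p p' →
        ReflTransGen S.Red q q' → ReflTransGen S.Red (p ++ q) (p' ++ q') := fun {_ p' q _} hp hq =>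
      (hp.lift (· ++ q) fun _ _ => Red.append_right q).trans
        (hq.lift (p' ++ ·) fun _ _ => Red.append_left p')
    exact ⟨u ++ v, append hxu hyv, append hxu' hyv'⟩

theorem Red.con {l l' : List (ℕ × C)} (h : S.Red l l') :
    S.con (FreeMonoid.ofList l) (FreeMonoid.ofList l') :=
  ⟨l', .single h, .refl⟩

/-- A word that admits no rewriting step represents `1` only if it is empty. -/
theorem eq_nil_of_con_one {l : List (ℕ × C)} (hl : ∀ l', ¬ S.Red l l')
    (h : S.con (FreeMonoid.ofList l) 1) : l = [] := by
  obtain ⟨u, hlu, hu⟩ := h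
  obtain rfl | ⟨_, h, _⟩ := hlu.cases_head
  · obtain h | ⟨_, h, _⟩ := hu.cases_head
    · exact h.symm
    · exact (not_red_nil _ h).elim
  · exact (hl _ h).elim

/-! ### Relabelling -/

variable {D : Type*} {T : CellSystem D} {φ : C → D}

theorem Red.map (htop : ∀ c, T.top (φ c) = S.top c) (hinv : ∀ c, φ (S.inv c) = T.inv (φ c))
    {l l' : List (ℕ × C)} (h : S.Red l l') :
    T.Red (l.map (Prod.map id φ)) (l'.map (Prod.map id φ)) := by
  have hbot : ∀ c, T.bot (φ c) = S.bot c := fun c => by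
    rw [← T.top_inv, ← hinv, htop, S.top_inv]
  induction h with
  | dipole l hd => exact .dipole _ (by rw [hd, hinv])
  | swap l k hm hm' => exact .swap _ k (by rw [htop]; exact hm) (by rw [hbot]; exact hm')
  | cons x h ih => exact .cons _ ih

/-- If `φ` reflects inverses among the letters of a word, then relabelling along `φ` creates no
new redex: swaps depend on the positions and the lengths only. -/
theorem Red.of_map (htop : ∀ c, T.top (φ c) = S.top c) {l : List (ℕ × C)} {w : List (ℕ × D)}
    (hφ : ∀ x ∈ l, ∀ y ∈ l, φ y.2 = T.inv (φ x.2) → y.2 = S.inv x.2)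
    (h : T.Red (l.map (Prod.map id φ)) w) : ∃ l', S.Red l l' := by
  induction l generalizing w with
  | nil => exact (not_red_nil _ h).elim
  | cons x l ih =>
    obtain ⟨m, d⟩ := x
    have rest : ∀ {w}, T.Red (l.map (Prod.map id φ)) w → ∃ l', S.Red ((m, d) :: l) l' := by
      intro w h
      obtain ⟨l', h'⟩ := ih (fun x hx y hy => hφ x (.tail _ hx) y (.tail _ hy)) h
      exact ⟨_, .cons _ h'⟩
    cases l with
    | nil =>
      cases h with
      | cons _ h => exact rest h
    | cons y l =>
      obtain ⟨n, c⟩ := y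
      cases h with
      | dipole _ hd => exact ⟨_, .dipole _ (hφ (m, d) (by simp) (m, c) (by simp) hd)⟩
      | swap _ k hm hm' => exact ⟨_, .swap _ k (by rw [← htop]; exact hm) rfl⟩
      | cons _ h => exact rest h

end CellSystem

/-! ### Words of 2-paths -/

/-- Of two prefixes of a path, the shorter one is a prefix of the longer one. -/
theorem Quiver.Path.exists_eq_comp_of_comp_eq {V : Type u} [Quiver.{v} V] {a b x y : V}
    {p : Quiver.Path a x} {q : Quiver.Path x b} {p' : Quiver.Path a y} {q' : Quiver.Path y b}
    (h : p.comp q = p'.comp q') (hle : p.length ≤ p'.length) :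
    ∃ r : Quiver.Path x y, p' = p.comp r ∧ q = r.comp q' := by
  induction q' with
  | nil => exact ⟨q, h.symm, rfl⟩
  | cons q' e ih =>
    cases q with
    | nil =>
      have := congrArg Quiver.Path.length h
      simp only [Quiver.Path.length_comp, Quiver.Path.length_nil, Quiver.Path.length_cons] at this
      omega
    | cons q e' =>
      simp only [Quiver.Path.comp_cons] at h
      obtain rfl := Quiver.Path.obj_eq_of_cons_eq_cons h
      obtain rfl := eq_of_heq (Quiver.Path.hom_heq_of_cons_eq_cons h)
      obtain ⟨r, hr, rfl⟩ := ih (eq_of_heq (Quiver.Path.heq_of_cons_eq_cons h))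
      exact ⟨r, hr, rfl⟩

namespace DirectedTwoComplex

variable {V : Type u} [Quiver.{v} V] (K : DirectedTwoComplex.{u, v, w} V) {a b : V}

/-- All 2-cells of `K`, gathered in one type. -/
abbrev TotalCell : Type max u w :=
  Σ x y : V, K.Cell x y

/-- The cell system of a directed 2-complex. -/
def cellSystem : CellSystem K.TotalCell where
  top c := (K.top c.2.2).length
  bot c := (K.bot c.2.2).length
  inv c := ⟨c.1, c.2.1, K.inv c.2.2⟩
  top_pos c := Nat.pos_of_ne_zero (K.top_nonempty c.2.2)
  inv_inv c := by rw [K.inv_inv]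
  top_inv c := by rw [K.top_inv]

variable {K}

namespace TwoPath

/-- The word of a 2-path: every atomic 2-path `(p, f, q)` is replaced by `(|p|, f)`. -/
def word {P Q : Quiver.Path a b} : K.TwoPath P Q → List (ℕ × K.TotalCell)
  | nil _ => []
  | cons s δ => (s.left.length, ⟨s.x, s.y, s.cell⟩) :: word δ

theorem word_comp {P Q R : Quiver.Path a b} (δ : K.TwoPath P Q) (ε : K.TwoPath Q R) :
    (comp δ ε).word = δ.word ++ ε.word := by
  induction δ with
  | nil P => rfl
  | cons s δ ih => simp only [comp, word, ih, List.cons_append]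

theorem Homotopic.con_word {P Q : Quiver.Path a b} {δ ε : K.TwoPath P Q} (h : Homotopic δ ε) :
    K.cellSystem.con (FreeMonoid.ofList δ.word) (FreeMonoid.ofList ε.word) := by
  induction h with
  | refl δ => exact Con.refl _ _
  | symm _ ih => exact Con.symm _ ih
  | trans _ _ ih ih' => exact Con.trans _ ih ih'
  | comp _ _ ih ih' =>
    rw [word_comp, word_comp]
    exact Con.mul _ ih ih'
  | dipole s => exact CellSystem.Red.con (.dipole _ rfl)
  | isotopy p f q g r =>
    exact Con.symm _ (CellSystem.Red.con (.swap _ q.length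
      (by simp only [Quiver.Path.length_comp]; rfl) (by simp only [Quiver.Path.length_comp]; rfl)))

/-- A dipole of the word comes from a dipole of the 2-path: the prefixes agree because they have
the same length and are prefixes of the same 1-path. -/
theorem eq_inv_of_dipole {P Q R : Quiver.Path a b} (s : K.AtomicTwoPath P Q)
    (t : K.AtomicTwoPath Q R) (hn : s.left.length = t.left.length)
    (hc : (⟨t.x, t.y, t.cell⟩ : K.TotalCell) = ⟨s.x, s.y, K.inv s.cell⟩) :
    R = P ∧ t ≍ s.inv := by
  obtain ⟨p, f, q, hP, hQ⟩ := s
  obtain ⟨p', f', q', hQ', hR⟩ := t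
  dsimp only at hn hc
  cases hc
  have h := hQ.symm.trans hQ'
  rw [Quiver.Path.comp_assoc, Quiver.Path.comp_assoc] at h
  obtain ⟨rfl, hq⟩ := (Quiver.Path.comp_inj' hn).1 h
  rw [K.top_inv] at hq
  obtain rfl := Quiver.Path.comp_inj_right.1 hq
  obtain rfl : R = P := by rw [hR, hP, K.bot_inv]
  exact ⟨rfl, HEq.rfl⟩

/-- Rewriting steps can be performed on 2-paths. -/
theorem exists_homotopic_of_red {P Q : Quiver.Path a b} (δ : K.TwoPath P Q)
    {w : List (ℕ × K.TotalCell)} (h : K.cellSystem.Red δ.word w) :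
    ∃ ε : K.TwoPath P Q, Homotopic δ ε ∧ ε.word = w := by
  induction δ generalizing w with
  | nil P => exact (CellSystem.not_red_nil _ h).elim
  | @cons P R Q s δ ih =>
    have rest : ∀ {w}, K.cellSystem.Red δ.word w → ∃ ε : K.TwoPath P Q,
        Homotopic (cons s δ) ε ∧ ε.word = (s.left.length, ⟨s.x, s.y, s.cell⟩) :: w := by
      intro w h
      obtain ⟨ε, hε, rfl⟩ := ih h
      exact ⟨cons s ε, .comp (.refl (single s)) hε, rfl⟩
    cases δ with
    | nil =>
      cases h with
      | cons _ h => exact rest h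
    | @cons _ S _ t δ =>
      simp only [word] at h
      generalize hm : s.left.length = m at h
      generalize hn : t.left.length = n at h
      generalize hd : (⟨s.x, s.y, s.cell⟩ : K.TotalCell) = d at h
      generalize hc : (⟨t.x, t.y, t.cell⟩ : K.TotalCell) = c at h
      cases h with
      | dipole _ h =>
        subst hd hc
        obtain ⟨rfl, ht⟩ := eq_inv_of_dipole s t (hm.trans hn.symm) h
        obtain rfl := eq_of_heq ht
        exact ⟨δ, .comp (.dipole s) (.refl δ), rfl⟩
      | swap _ k hmn hm' =>
        subst hm hn hd hc hm'
        obtain ⟨p', g, r, hP, hR⟩ := s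
        obtain ⟨p, f, q', hR', hS⟩ := t
        have hlen : p'.length = p.length + (K.top f).length + k := hmn
        have h := hR'.symm.trans hR
        rw [Quiver.Path.comp_assoc p'] at h
        obtain ⟨q, rfl, hq'⟩ := Quiver.Path.exists_eq_comp_of_comp_eq h
          (by rw [Quiver.Path.length_comp]; omega)
        rw [← Quiver.Path.comp_assoc] at hq'
        subst hq'
        obtain rfl : q.length = k := by 
          rw [Quiver.Path.length_comp, Quiver.Path.length_comp] at hlen; omega
        obtain rfl : S = (((p.comp (K.bot f)).comp q).comp (K.bot g)).comp r := by
          simp only [hS, Quiver.Path.comp_assoc]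
        subst hP hR
        refine ⟨comp (leftFirst p f q g r) δ, ?_, ?_⟩
        · exact .comp (.symm (.isotopy p f q g r)) (.refl δ)
        · simp only [leftFirst, single, comp, word, Quiver.Path.length_comp]
          rfl
      | cons _ h =>
        subst hm hd
        rw [← hn, ← hc] at h
        exact rest h

end TwoPath

/-- Every element of a diagram group is represented by a reduced 2-path whose independent atoms are
ordered from left to right. -/
theorem DiagramGroup.exists_irreducible {p : Quiver.Path a b} (g : K.DiagramGroup p) :
    ∃ δ : K.TwoPath p p, Quotient.mk (K.homotopySetoid p) δ = g ∧
      ∀ w, ¬ K.cellSystem.Red δ.word w := by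
  have wf : WellFounded fun ε δ : K.TwoPath p p => K.cellSystem.Red δ.word ε.word :=
    InvImage.wf TwoPath.word CellSystem.Red.wellFounded
  obtain ⟨δ, hδ, hmin⟩ := wf.has_min {δ | Quotient.mk (K.homotopySetoid p) δ = g}
    (Quotient.exists_rep g)
  refine ⟨δ, hδ, fun w hw => ?_⟩
  obtain ⟨ε, hε, rfl⟩ := δ.exists_homotopic_of_red hw
  exact hmin ε ((Quotient.sound (s := K.homotopySetoid p) hε.symm).trans hδ) hw

/-! ### Countable labels -/

variable (K) in
/-- A choice of a positive cell in every pair of mutually inverse cells. -/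
theorem exists_orientation : ∃ o : K.TotalCell → Bool, ∀ c, o (K.cellSystem.inv c) = !o c := by
  classical
  -- A cell is positive if it precedes its inverse in a fixed linear order.
  let _ : LinearOrder K.TotalCell := linearOrderOfSTO WellOrderingRel
  refine ⟨fun c => decide (c < K.cellSystem.inv c), fun c => ?_⟩
  have hne : K.cellSystem.inv c ≠ c := fun h => by
    obtain ⟨x, y, f⟩ := c
    simp only [cellSystem, Sigma.mk.injEq, heq_eq_eq, true_and] at h
    exact K.inv_ne f h
  dsimp only
  rw [K.cellSystem.inv_inv]
  rcases lt_or_gt_of_ne hne with h | h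
  · simp [h, h.not_gt]
  · simp [h, h.not_gt]

/-- Countably many labels for 2-cells: the length of the top path minus one, the length of the
bottom path minus one, the orientation, and a number that separates cells for which the other
data agree. -/
abbrev Label : Type :=
  ℕ × ℕ × Bool × ℕ

/-- The cell system of labels; inversion exchanges top and bottom and the two orientations. -/
def labelSystem : CellSystem Label where
  top c := c.1 + 1
  bot c := c.2.1 + 1
  inv c := (c.2.1, c.1, !c.2.2.1, c.2.2.2)
  top_pos _ := Nat.succ_pos _
  inv_inv c := by simp
  top_inv _ := rfl

/-- There is a labelling of the 2-cells, compatible with lengths and inversion, under which a given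
finite list of 2-cells acquires no new pairs of mutually inverse cells. -/
theorem exists_labelling (L : List K.TotalCell) : ∃ φ : K.TotalCell → Label,
    (∀ c, labelSystem.top (φ c) = K.cellSystem.top c) ∧
    (∀ c, φ (K.cellSystem.inv c) = labelSystem.inv (φ c)) ∧
    ∀ c ∈ L, ∀ d ∈ L, φ d = labelSystem.inv (φ c) → d = K.cellSystem.inv c := by
  classical
  obtain ⟨o, ho⟩ := K.exists_orientation
  -- The pairs `{c, c⁻¹}` with `c` in the list are numbered by their first occurrence; all the
  -- other pairs share the number `L.length`.
  let pair : K.TotalCell → Sym2 K.TotalCell := fun c => s(c, K.cellSystem.inv c)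
  have pair_inv : ∀ c, pair (K.cellSystem.inv c) = pair c := fun c => by
    simp only [pair, K.cellSystem.inv_inv, Sym2.eq_swap]
  refine ⟨fun c => (K.cellSystem.top c - 1, K.cellSystem.bot c - 1, o c,
    (L.map pair).idxOf (pair c)), fun c => Nat.sub_add_cancel (K.cellSystem.top_pos c),
    fun c => ?_, fun c hc d hd h => ?_⟩
  · simp only [labelSystem, K.cellSystem.top_inv, K.cellSystem.bot_inv, ho, pair_inv]
  · simp only [labelSystem, Prod.mk.injEq] at h
    obtain ⟨-, -, hod, hidx⟩ := h
    have hpair : pair d = pair c := (List.idxOf_inj (List.mem_map_of_mem hd)).1 hidx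
    rcases Sym2.eq_iff.1 hpair with ⟨rfl, -⟩ | ⟨h, -⟩
    · simp at hod
    · exact h

variable {C : Type*} {T : CellSystem C} {φ : K.TotalCell → C}

theorem TwoPath.Homotopic.con_map_word (htop : ∀ c, T.top (φ c) = K.cellSystem.top c)
    (hinv : ∀ c, φ (K.cellSystem.inv c) = T.inv (φ c)) {P Q : Quiver.Path a b}
    {δ ε : K.TwoPath P Q} (h : TwoPath.Homotopic δ ε) :
    T.con (FreeMonoid.ofList (δ.word.map (Prod.map id φ)))
      (FreeMonoid.ofList (ε.word.map (Prod.map id φ))) := by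
  obtain ⟨u, hδ, hε⟩ := h.con_word
  exact ⟨u.map (Prod.map id φ),
    hδ.lift (List.map (Prod.map id φ)) fun _ _ => CellSystem.Red.map htop hinv,
    hε.lift (List.map (Prod.map id φ)) fun _ _ => CellSystem.Red.map htop hinv⟩

/-- A labelling compatible with lengths and inversion induces a homomorphism from the diagram group
to the monoid presented by the rewriting rules. -/
def DiagramGroup.labelHom (htop : ∀ c, T.top (φ c) = K.cellSystem.top c)
    (hinv : ∀ c, φ (K.cellSystem.inv c) = T.inv (φ c)) (p : Quiver.Path a b) :
    K.DiagramGroup p →* T.con.Quotient where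
  toFun := Quotient.lift (fun δ => (FreeMonoid.ofList (δ.word.map (Prod.map id φ)) :
    T.con.Quotient)) fun _ _ h => (Con.eq _).2 (TwoPath.Homotopic.con_map_word htop hinv h)
  map_one' := rfl
  map_mul' := by
    rintro ⟨δ⟩ ⟨ε⟩
    change ((FreeMonoid.ofList ((TwoPath.comp δ ε).word.map (Prod.map id φ)) :
      FreeMonoid (ℕ × C)) : T.con.Quotient) = _
    rw [TwoPath.word_comp, List.map_append]
    rfl

end DirectedTwoComplex

/-- It is enough to find a homomorphism to a countable monoid: a group is mapped to its units. -/
theorem MonoidHom.exists_surjective_countable {G : Type*} [Group G] {M : Type} [Monoid M]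
    [Countable M] (f : G →* M) {g : G} (hg : f g ≠ 1) :
    ∃ (H : Type) (_ : Group H) (φ : G →* H),
      Countable H ∧ Function.Surjective φ ∧ φ g ≠ 1 := by
  have : Countable Mˣ := Function.Injective.countable (f := Units.val) Units.val_injective
  refine ⟨f.toHomUnits.range, inferInstance, f.toHomUnits.rangeRestrict, inferInstance,
    f.toHomUnits.rangeRestrict_surjective, fun h => hg ?_⟩
  exact congrArg (fun x : f.toHomUnits.range => ((x : Mˣ) : M)) h

theorem theorem6p2 {V : Type u} [Quiver.{v} V] (K : DirectedTwoComplex.{u, v, w} V) {a b : V}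
    (p : Quiver.Path a b) : IsResiduallyCountable (K.DiagramGroup p) := by
  intro g hg
  obtain ⟨δ, rfl, hδ⟩ := DirectedTwoComplex.DiagramGroup.exists_irreducible g
  obtain ⟨φ, htop, hinv, hφ⟩ := DirectedTwoComplex.exists_labelling (δ.word.map Prod.snd)
  have : Countable (FreeMonoid (ℕ × DirectedTwoComplex.Label)) :=
    inferInstanceAs (Countable (List (ℕ × DirectedTwoComplex.Label)))
  have : Countable DirectedTwoComplex.labelSystem.con.Quotient :=
    inferInstanceAs (Countable (Quotient _))
  refine (DirectedTwoComplex.DiagramGroup.labelHom htop hinv p).exists_surjective_countable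
    fun h => hg ?_
  -- The labelled word is still irreducible, so it would be empty.
  have hnil : δ.word.map (Prod.map id φ) = [] :=
    CellSystem.eq_nil_of_con_one (fun w hw => by
      obtain ⟨l, hl⟩ := hw.of_map htop fun x hx y hy =>
        hφ x.2 (List.mem_map_of_mem hx) y.2 (List.mem_map_of_mem hy)
      exact hδ l hl) ((Con.eq _).1 h)
  cases δ with
  | nil => rfl
  | cons s δ => simp [DirectedTwoComplex.TwoPath.word] at hnil
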